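/- Let $\Omega_n$ denote the set of $n\times n$ complex positive semidefinite matrices of trace one. For $\rho^A,\rho^B\in\Omega_2$ let $\Gamma^Q(\rho^A,\rho^B)$ be the set of all density matrices $\rho^{AB}\in\Omega_4$ on $\mathbb{C}^2\otimes\mathbb{C}^2$ whose partial traces are $\mathrm{tr}_B\,\rho^{AB}=\rho^A$ and $\mathrm{tr}_A\,\rho^{AB}=\rho^B$. Let $C^Q=\frac12(\mathbb{I}-S)$, where $S$ is the SWAP operator $x\otimes y\mapsto y\otimes x$ on $\mathbb{C}^2\otimes\mathbb{C}^2$, and let $$\mathrm{T}^Q_{C^Q}(\rho^A,\rho^B)=\min_{\rho^{AB}\in\Gamma^Q(\rho^A,\rho^B)}\mathrm{tr}\,(C^Q\rho^{AB})$$ be the quantum optimal transport cost. Theorem. For all $\rho^A,\rho^B\in\Omega_2$ (the minimum above and the maximum below being attained), $$\mathrm{T}^Q_{C^Q}(\rho^A,\rho^B)=\frac12\max_{U\in\mathrm{U}(2)}\Big(\sqrt{(U^\dagger\rho^AU)_{11}}-\sqrt{(U^\dagger\rho^BU)_{11}}\Big)^2,$$ where $\mathrm{U}(2)$ is the group of $2\times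 2$ unitary matrices. -/

import Mathlib

namespace QOT

open scoped Matrix ComplexOrder

variable {m n : Type*} [Fintype m] [Fintype n]

/-- Density matrices: positive semidefinite (in particular Hermitian) complex matrices
of trace one. -/
def densityMatrices (n : Type*) [Fintype n] : Set (Matrix n n ℂ) :=
  {ρ | ρ.PosSemidef ∧ ρ.trace = 1}

/-- The partial trace over the first factor, `(tr_A R)_{pq} = ∑ i, R_{(i,p)(i,q)}`. -/
def partialTraceA (R : Matrix (m × n) (m × n) ℂ) : Matrix n n ℂ :=
  Matrix.of fun p q => ∑ i, R (i, p) (i, q)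

/-- The partial trace over the second factor, `(tr_B R)_{ij} = ∑ p, R_{(i,p)(j,p)}`. -/
def partialTraceB (R : Matrix (m × n) (m × n) ℂ) : Matrix m m ℂ :=
  Matrix.of fun i j => ∑ p, R (i, p) (j, p)

/-- Quantum couplings of `ρA` and `ρB`: bipartite density matrices with these marginals. -/
def couplings (ρA : Matrix m m ℂ) (ρB : Matrix n n ℂ) : Set (Matrix (m × n) (m × n) ℂ) :=
  {R | R ∈ densityMatrices (m × n) ∧ partialTraceB R = ρA ∧ partialTraceA R = ρB}

/-- The set of values `tr (C R)` over the couplings `R` of `ρA` and `ρB`. For Hermitian `C` these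
traces are real numbers, so that taking the real part only changes the type. -/
def transportCosts (C : Matrix (m × n) (m × n) ℂ) (ρA : Matrix m m ℂ) (ρB : Matrix n n ℂ) :
    Set ℝ :=
  (fun R => (C * R).trace.re) '' couplings ρA ρB

/-- The quantum optimal transport cost `T^Q_C(ρA, ρB)`, the minimum of the transport costs. -/
noncomputable def transport (C : Matrix (m × n) (m × n) ℂ) (ρA : Matrix m m ℂ)
    (ρB : Matrix n n ℂ) : ℝ :=
  sInf (transportCosts C ρA ρB)

/-- The matrix of the SWAP operator `x ⊗ y ↦ y ⊗ x`. -/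
def swapMatrix (n : Type*) [DecidableEq n] : Matrix (n × n) (n × n) ℂ :=
  Matrix.of fun a b => if a = b.swap then 1 else 0

/-- The cost matrix `C^Q = (I - SWAP) / 2`. -/
noncomputable def costQ (n : Type*) [DecidableEq n] : Matrix (n × n) (n × n) ℂ :=
  (1 / 2 : ℂ) • (1 - swapMatrix n)

/-- The quantity `(√((U† ρA U)₁₁) - √((U† ρB U)₁₁))²` of a unitary matrix `U`; the diagonal
entries of positive semidefinite matrices are non-negative reals. -/
noncomputable def sqrtGap (ρA ρB : Matrix (Fin 2) (Fin 2) ℂ)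
    (U : Matrix.unitaryGroup (Fin 2) ℂ) : ℝ :=
  (√(((U.1ᴴ * ρA * U.1) 0 0).re) - √(((U.1ᴴ * ρB * U.1) 0 0).re)) ^ 2

end QOT

/-!
The cost is invariant under `U ⊗ U`, because `U ⊗ U` commutes with SWAP. So both inequalities can
be proved in any convenient basis.

*Lower bound.* Writing `R p p` for the diagonal entries of a coupling `R` and `p'` for the swap of
`p`, positivity of the `2 × 2` minors gives `tr (C R) ≥ ¼ ∑ p, (√(R p p) - √(R p' p'))²`. Keeping
only the terms in which the index `i` occurs and using the reverse triangle inequality in `ℓ²`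
leaves `½ (√(ρA i i) - √(ρB i i))²`.

*Upper bound.* Rotate a maximizing unitary to the identity, so that the first basis vector maximizes
`(√⟨x, ρA x⟩ - √⟨x, ρB x⟩)² / ‖x‖²`. If the maximum is zero, then `ρA = ρB`, and the diagonal
self-coupling in an eigenbasis costs nothing. Otherwise let `a ≠ b` be the upper left entries. The
Euler-Lagrange equation says that the lower left entries are `√a z` and `√b z` for a common `z`.
Since `(√(p + t) - √(q + t))²` is strictly decreasing in `t`, maximality against the vector
`(-conj z, √a + √b)` forces `|z|² ≤ 1 - a - b`. This is exactly the condition under which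
`|ψ⟩⟨ψ| + (1 - a - b - |z|²) |11⟩⟨11|` with `ψ = √a |01⟩ + √b |10⟩ + z |11⟩` is a coupling, and its
cost is `½ (√a - √b)²`.
-/

namespace QOT

open scoped Matrix ComplexOrder Kronecker ComplexConjugate

section QuadraticForm

variable {n : Type*} [Fintype n]

/-- The quadratic form `⟨x, ρ x⟩` of a matrix `ρ`, which is real if `ρ` is Hermitian; the real part
only changes the type. For a state `ρ` and a unit vector `x` it is the probability of finding `ρ`
in the state `x`. -/
noncomputable def quadForm (ρ : Matrix n n ℂ) (x : n → ℂ) : ℝ :=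
  (star x ⬝ᵥ ρ *ᵥ x).re

lemma quadForm_nonneg {ρ : Matrix n n ℂ} (hρ : ρ.PosSemidef) (x : n → ℂ) : 0 ≤ quadForm ρ x :=
  hρ.re_dotProduct_nonneg x

lemma quadForm_smul (ρ : Matrix n n ℂ) (s : ℝ) (x : n → ℂ) :
    quadForm ρ (s • x) = s ^ 2 * quadForm ρ x := by
  simp only [quadForm, star_smul, star_trivial, Matrix.mulVec_smul, smul_dotProduct,
    dotProduct_smul, Complex.smul_re, smul_eq_mul]
  ring

lemma quadForm_add {ρ : Matrix n n ℂ} (hρ : ρ.IsHermitian) (x y : n → ℂ) :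
    quadForm ρ (x + y) = quadForm ρ x + 2 * (star y ⬝ᵥ ρ *ᵥ x).re + quadForm ρ y := by
  have hsymm : (star x ⬝ᵥ ρ *ᵥ y).re = (star y ⬝ᵥ ρ *ᵥ x).re := by
    rw [Matrix.dotProduct_mulVec, ← hρ.eq, ← Matrix.star_mulVec, hρ.eq, Matrix.star_dotProduct,
      ← Complex.conj_re]
    rfl
  simp only [quadForm, star_add, Matrix.mulVec_add, add_dotProduct, dotProduct_add,
    Complex.add_re, hsymm]
  ring

lemma quadForm_single [DecidableEq n] (ρ : Matrix n n ℂ) (i : n) :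
    quadForm ρ (Pi.single i 1) = (ρ i i).re := by
  simp [quadForm]

lemma quadForm_col (ρ U : Matrix n n ℂ) (i : n) :
    quadForm ρ (U.col i) = ((Uᴴ * ρ * U) i i).re := by
  rw [Matrix.mul_mul_apply]
  rfl

lemma quadForm_one_eq_zero [DecidableEq n] {x : n → ℂ} : quadForm 1 x = 0 ↔ x = 0 := by
  have him := (Complex.nonneg_iff.1 (dotProduct_star_self_nonneg x)).2
  rw [← dotProduct_star_self_eq_zero, Complex.ext_iff, ← him, quadForm, Matrix.one_mulVec]
  simp only [Complex.zero_re, Complex.zero_im, and_true]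

lemma ext_re_dotProduct {u v : n → ℂ} (h : ∀ y, (star y ⬝ᵥ u).re = (star y ⬝ᵥ v).re) : u = v := by
  classical
  rw [← sub_eq_zero, ← quadForm_one_eq_zero, quadForm, Matrix.one_mulVec, dotProduct_sub,
    Complex.sub_re, h, sub_self]

lemma ext_quadForm {ρ σ : Matrix n n ℂ} (hρ : ρ.IsHermitian) (hσ : σ.IsHermitian)
    (h : ∀ x, quadForm ρ x = quadForm σ x) : ρ = σ := by
  refine Matrix.ext_iff_mulVec.2 fun x => ext_re_dotProduct fun y => ?_
  have hxy := h (x + y)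
  rw [quadForm_add hρ, quadForm_add hσ, h x, h y] at hxy
  linarith

lemma hasDerivAt_quadForm {ρ : Matrix n n ℂ} (hρ : ρ.IsHermitian) (x y : n → ℂ) :
    HasDerivAt (fun s : ℝ => quadForm ρ (x + s • y)) (2 * (star y ⬝ᵥ ρ *ᵥ x).re) 0 := by
  have hpoly (s : ℝ) : quadForm ρ (x + s • y) =
      quadForm ρ x + s * (2 * (star y ⬝ᵥ ρ *ᵥ x).re) + s ^ 2 * quadForm ρ y := by
    rw [quadForm_add hρ, quadForm_smul, star_smul, star_trivial, smul_dotProduct, Complex.smul_re,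
      smul_eq_mul]
    ring
  simp only [hpoly]
  simpa using! (((hasDerivAt_id (0 : ℝ)).mul_const (2 * (star y ⬝ᵥ ρ *ᵥ x).re)).const_add
    (quadForm ρ x)).add (((hasDerivAt_id (0 : ℝ)).pow 2).mul_const (quadForm ρ y))

lemma hasDerivAt_sqrt_quadForm {ρ : Matrix n n ℂ} (hρ : ρ.IsHermitian) {x : n → ℂ}
    (hx : 0 < quadForm ρ x) (y : n → ℂ) :
    HasDerivAt (fun s : ℝ => √(quadForm ρ (x + s • y)))
      ((star y ⬝ᵥ ρ *ᵥ x).re / √(quadForm ρ x)) 0 := by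
  have h := (hasDerivAt_quadForm hρ x y).sqrt (by simpa using hx.ne')
  simpa [mul_div_mul_left] using h

lemma euler_lagrange_sqrt_quadForm_sub [DecidableEq n] {ρ σ : Matrix n n ℂ} (hρ : ρ.IsHermitian)
    (hσ : σ.IsHermitian) {x : n → ℂ} (hρx : 0 < quadForm ρ x) (hσx : 0 < quadForm σ x) {c : ℝ}
    (hle : ∀ y, (√(quadForm ρ y) - √(quadForm σ y)) ^ 2 ≤ c * quadForm 1 y)
    (heq : (√(quadForm ρ x) - √(quadForm σ x)) ^ 2 = c * quadForm 1 x) :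
    (√(quadForm ρ x) - √(quadForm σ x)) •
      ((√(quadForm ρ x))⁻¹ • ρ *ᵥ x - (√(quadForm σ x))⁻¹ • σ *ᵥ x) = c • x := by
  refine ext_re_dotProduct fun y => ?_
  have hderiv := (((hasDerivAt_sqrt_quadForm hρ hρx y).sub
    (hasDerivAt_sqrt_quadForm hσ hσx y)).pow 2).sub
    ((hasDerivAt_quadForm Matrix.isHermitian_one x y).const_mul c)
  have hmax : IsLocalMax (fun s : ℝ => (√(quadForm ρ (x + s • y)) - √(quadForm σ (x + s • y))) ^ 2
      - c * quadForm 1 (x + s • y)) 0 :=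
    Filter.Eventually.of_forall fun s => by
      simpa [heq] using hle (x + s • y)
  have hzero := hmax.hasDerivAt_eq_zero hderiv
  simp only [Matrix.one_mulVec, zero_smul, add_zero, Pi.sub_apply, Nat.cast_ofNat,
    Nat.add_one_sub_one, pow_one] at hzero
  simp only [dotProduct_smul, dotProduct_sub, Complex.smul_re, Complex.sub_re, smul_eq_mul]
  rw [div_eq_inv_mul, div_eq_inv_mul] at hzero
  linarith

end QuadraticForm

section Unitary

variable {n : Type*} [Fintype n] [DecidableEq n]

lemma conj_conj_star (U : Matrix.unitaryGroup n ℂ) (ρ : Matrix n n ℂ) :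
    (star U).1ᴴ * (U.1ᴴ * ρ * U.1) * (star U).1 = ρ := by
  have hU : U.1 * U.1ᴴ = 1 := Matrix.mem_unitaryGroup_iff.1 U.2
  calc U.1ᴴᴴ * (U.1ᴴ * ρ * U.1) * U.1ᴴ
      = (U.1 * U.1ᴴ) * ρ * (U.1 * U.1ᴴ) := by
        rw [Matrix.conjTranspose_conjTranspose]; simp only [Matrix.mul_assoc]
    _ = ρ := by rw [hU, Matrix.one_mul, Matrix.mul_one]

lemma exists_mem_unitaryGroup_col_eq {x : n → ℂ} (hx : quadForm 1 x = 1) (i : n) :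
    ∃ U : Matrix.unitaryGroup n ℂ, U.1.col i = x := by
  have hnorm : ‖WithLp.toLp 2 x‖ ^ 2 = 1 := by
    rw [EuclideanSpace.norm_sq_eq, ← hx]
    simp [quadForm, dotProduct, ← Complex.normSq_eq_norm_sq, Complex.normSq_apply]
  have horth : Orthonormal ℂ (({i} : Set n).domRestrict fun _ => WithLp.toLp 2 x) :=
    ⟨fun _ => (pow_eq_one_iff_of_nonneg (norm_nonneg _) two_ne_zero).1 hnorm,
      fun j k hjk => (hjk (Subsingleton.elim j k)).elim⟩
  obtain ⟨b, hb⟩ := horth.exists_orthonormalBasis_extension_of_card_eq finrank_euclideanSpace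
  refine ⟨⟨_, (EuclideanSpace.basisFun n ℂ).toMatrix_orthonormalBasis_mem_unitary b⟩, ?_⟩
  ext j
  simp [Module.Basis.toMatrix_apply, hb i rfl]

lemma isCompact_unitaryGroup :
    IsCompact (Matrix.unitaryGroup n ℂ : Set (Matrix n n ℂ)) := by
  refine IsCompact.of_isClosed_subset
    (isCompact_univ_pi fun _ : n => isCompact_univ_pi fun _ : n =>
      isCompact_closedBall (0 : ℂ) 1) isClosed_unitary fun U hU i _ j _ => ?_
  simpa using entry_norm_bound_of_unitary hU i j

end Unitary

section Invariance

variable {m n : Type*} [Fintype m] [Fintype n]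

lemma trace_kronecker_one_mul [DecidableEq n] (X : Matrix m m ℂ) (R : Matrix (m × n) (m × n) ℂ) :
    ((X ⊗ₖ (1 : Matrix n n ℂ)) * R).trace = (X * partialTraceB R).trace := by
  simp only [Matrix.trace, Matrix.diag, Matrix.mul_apply, Fintype.sum_prod_type, partialTraceB,
    Matrix.kroneckerMap_apply, Matrix.one_apply, Matrix.of_apply, mul_ite, ite_mul, mul_one,
    mul_zero, zero_mul, Finset.sum_ite_eq, Finset.mem_univ, if_true, Finset.mul_sum]
  exact Finset.sum_congr rfl fun i _ => Finset.sum_comm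

lemma trace_one_kronecker_mul [DecidableEq m] (X : Matrix n n ℂ) (R : Matrix (m × n) (m × n) ℂ) :
    (((1 : Matrix m m ℂ) ⊗ₖ X) * R).trace = (X * partialTraceA R).trace := by
  simp only [Matrix.trace, Matrix.diag, Matrix.mul_apply, Fintype.sum_prod_type_right,
    partialTraceA, Matrix.kroneckerMap_apply, Matrix.one_apply, Matrix.of_apply, ite_mul, one_mul,
    zero_mul, Finset.sum_ite_eq, Finset.mem_univ, if_true, Finset.mul_sum]
  exact Finset.sum_congr rfl fun i _ => Finset.sum_comm

lemma trace_mul_conj (X V R : Matrix n n ℂ) :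
    (X * (Vᴴ * R * V)).trace = (V * X * Vᴴ * R).trace := by
  rw [← Matrix.mul_assoc, Matrix.trace_mul_comm]
  simp only [Matrix.mul_assoc]

lemma partialTraceB_conj [DecidableEq n] (U : Matrix m m ℂ) (V : Matrix.unitaryGroup n ℂ)
    (R : Matrix (m × n) (m × n) ℂ) :
    partialTraceB ((U ⊗ₖ V.1)ᴴ * R * (U ⊗ₖ V.1)) = Uᴴ * partialTraceB R * U := by
  refine Matrix.ext_iff_trace_mul_left.2 fun X => ?_
  have hV : V.1 * V.1ᴴ = 1 := Matrix.mem_unitaryGroup_iff.1 V.2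
  rw [← trace_kronecker_one_mul, trace_mul_conj, trace_mul_conj, ← trace_kronecker_one_mul,
    Matrix.conjTranspose_kronecker, ← Matrix.mul_kronecker_mul, ← Matrix.mul_kronecker_mul,
    Matrix.mul_one, hV]

lemma partialTraceA_conj [DecidableEq m] (U : Matrix.unitaryGroup m ℂ) (V : Matrix n n ℂ)
    (R : Matrix (m × n) (m × n) ℂ) :
    partialTraceA ((U.1 ⊗ₖ V)ᴴ * R * (U.1 ⊗ₖ V)) = Vᴴ * partialTraceA R * V := by
  refine Matrix.ext_iff_trace_mul_left.2 fun X => ?_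
  have hU : U.1 * U.1ᴴ = 1 := Matrix.mem_unitaryGroup_iff.1 U.2
  rw [← trace_one_kronecker_mul, trace_mul_conj, trace_mul_conj, ← trace_one_kronecker_mul,
    Matrix.conjTranspose_kronecker, ← Matrix.mul_kronecker_mul, ← Matrix.mul_kronecker_mul,
    Matrix.mul_one, hU]

variable [DecidableEq n]

lemma kronecker_mul_swapMatrix (U V : Matrix n n ℂ) :
    (U ⊗ₖ V) * swapMatrix n = swapMatrix n * (V ⊗ₖ U) := by
  ext ⟨i, j⟩ ⟨k, l⟩
  have hswap (x : n × n) : (i, j) = x.swap ↔ x = (j, i) := by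
    rw [eq_comm, Prod.swap_eq_iff_eq_swap, Prod.swap_prod_mk]
  simp [Matrix.mul_apply, swapMatrix, hswap, mul_comm]

lemma kronecker_conj_costQ (U : Matrix.unitaryGroup n ℂ) :
    (U.1 ⊗ₖ U.1) * costQ n * (U.1 ⊗ₖ U.1)ᴴ = costQ n := by
  have hU : U.1 * U.1ᴴ = 1 := Matrix.mem_unitaryGroup_iff.1 U.2
  have hcomm : (U.1 ⊗ₖ U.1) * costQ n = costQ n * (U.1 ⊗ₖ U.1) := by
    simp [costQ, Matrix.mul_sub, Matrix.sub_mul, kronecker_mul_swapMatrix]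
  rw [hcomm, Matrix.mul_assoc, Matrix.conjTranspose_kronecker, ← Matrix.mul_kronecker_mul, hU,
    Matrix.one_kronecker_one, Matrix.mul_one]

lemma conj_mem_densityMatrices {ρ : Matrix n n ℂ} (hρ : ρ ∈ densityMatrices n)
    (U : Matrix.unitaryGroup n ℂ) : U.1ᴴ * ρ * U.1 ∈ densityMatrices n := by
  have hU : U.1 * U.1ᴴ = 1 := Matrix.mem_unitaryGroup_iff.1 U.2
  refine ⟨hρ.1.conjTranspose_mul_mul_same _, ?_⟩
  rw [Matrix.trace_mul_comm, ← Matrix.mul_assoc, hU, Matrix.one_mul, hρ.2]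

lemma conj_mem_transportCosts {ρA ρB : Matrix n n ℂ} {c : ℝ}
    (hc : c ∈ transportCosts (costQ n) ρA ρB) (U : Matrix.unitaryGroup n ℂ) :
    c ∈ transportCosts (costQ n) (U.1ᴴ * ρA * U.1) (U.1ᴴ * ρB * U.1) := by
  obtain ⟨R, ⟨hR, rfl, rfl⟩, rfl⟩ := hc
  let W : Matrix.unitaryGroup (n × n) ℂ :=
    ⟨U.1 ⊗ₖ U.1, Matrix.kronecker_mem_unitary U.2 U.2⟩
  refine ⟨W.1ᴴ * R * W.1,
    ⟨conj_mem_densityMatrices hR W, partialTraceB_conj _ _ _, partialTraceA_conj _ _ _⟩, ?_⟩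
  simp only [trace_mul_conj, W, kronecker_conj_costQ]

lemma transportCosts_conj (ρA ρB : Matrix n n ℂ) (U : Matrix.unitaryGroup n ℂ) :
    transportCosts (costQ n) (U.1ᴴ * ρA * U.1) (U.1ᴴ * ρB * U.1) =
      transportCosts (costQ n) ρA ρB := by
  refine Set.Subset.antisymm (fun c hc => ?_) fun c hc => conj_mem_transportCosts hc U
  simpa only [conj_conj_star] using conj_mem_transportCosts hc (star U)

end Invariance

section LowerBound

lemma norm_apply_le_of_posSemidef {k : Type*} {M : Matrix k k ℂ} (hM : M.PosSemidef) (i j : k) :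
    ‖M i j‖ ≤ √(M i i).re * √(M j j).re := by
  have hi := Complex.nonneg_iff.1 (hM.diag_nonneg (i := i))
  have hj := Complex.nonneg_iff.1 (hM.diag_nonneg (i := j))
  have hdet := (Complex.nonneg_iff.1 (hM.submatrix ![i, j]).det_nonneg).1
  have hji : M j i = conj (M i j) := (hM.1.apply j i).symm
  simp only [Matrix.det_fin_two, Matrix.submatrix_apply, Matrix.cons_val_zero, Matrix.cons_val_one,
    hji, Complex.sub_re, Complex.mul_conj, Complex.ofReal_re, Complex.mul_re, ← hi.2, ← hj.2,
    mul_zero, sub_zero] at hdet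
  rw [← Real.sqrt_mul hi.1]
  apply Real.le_sqrt_of_sq_le
  rw [← Complex.normSq_eq_norm_sq]
  linarith

lemma sq_sqrt_sum_sub_sqrt_sum_le {ι : Type*} [Fintype ι] {p q : ι → ℝ} (hp : ∀ i, 0 ≤ p i)
    (hq : ∀ i, 0 ≤ q i) : (√(∑ i, p i) - √(∑ i, q i)) ^ 2 ≤ ∑ i, (√(p i) - √(q i)) ^ 2 := by
  have hnorm {r : ι → ℝ} (hr : ∀ i, 0 ≤ r i) :
      ‖WithLp.toLp 2 fun i => √(r i)‖ = √(∑ i, r i) := by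
    simp [EuclideanSpace.norm_eq, Real.sq_sqrt (hr _)]
  have h := abs_norm_sub_norm_le (WithLp.toLp 2 fun i => √(p i)) (WithLp.toLp 2 fun i => √(q i))
  rw [hnorm hp, hnorm hq] at h
  simpa [EuclideanSpace.norm_sq_eq] using sq_le_sq' (neg_le_of_abs_le h) (le_of_abs_le h)

lemma two_mul_sum_row_le_sum {n : Type*} [Fintype n] {f : n × n → ℝ} (hf : ∀ p, 0 ≤ f p)
    (hswap : ∀ p, f p.swap = f p) {i : n} (hi : f (i, i) = 0) :
    2 * ∑ j, f (i, j) ≤ ∑ p, f p := by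
  classical
  have hcol : ∑ k ∈ Finset.univ.erase i, f (i, k) = ∑ j, f (i, j) :=
    Finset.sum_erase _ hi
  have hrow (k : n) : f (i, k) ≤ ∑ j, f (k, j) :=
    (hswap (k, i)).le.trans
      (Finset.single_le_sum (fun j _ => hf (k, j)) (Finset.mem_univ i))
  calc 2 * ∑ j, f (i, j) = ∑ j, f (i, j) + ∑ k ∈ Finset.univ.erase i, f (i, k) := by
        rw [hcol, two_mul]
    _ ≤ ∑ j, f (i, j) + ∑ k ∈ Finset.univ.erase i, ∑ j, f (k, j) := by
        gcongr with k
        exact hrow k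
    _ = ∑ p, f p := by
        rw [Finset.add_sum_erase _ (fun k => ∑ j, f (k, j)) (Finset.mem_univ i),
          Fintype.sum_prod_type]

variable {n : Type*} [Fintype n] [DecidableEq n]

lemma trace_costQ_mul (R : Matrix (n × n) (n × n) ℂ) :
    (costQ n * R).trace = 1 / 2 * ∑ p, (R p p - R p.swap p) := by
  have hswap (p q : n × n) : p = q.swap ↔ q = p.swap := by
    rw [eq_comm, Prod.swap_eq_iff_eq_swap]
  simp [costQ, swapMatrix, Matrix.trace, Matrix.sub_mul, Matrix.mul_apply, hswap, mul_sub,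
    Finset.mul_sum]

lemma sum_sq_sqrt_sub_sqrt_le_re_trace_costQ_mul {R : Matrix (n × n) (n × n) ℂ}
    (hR : R.PosSemidef) :
    1 / 4 * ∑ p, (√(R p p).re - √(R p.swap p.swap).re) ^ 2 ≤ (costQ n * R).trace.re := by
  have hterm (p : n × n) : (√(R p p).re - √(R p.swap p.swap).re) ^ 2 ≤
      (R p p).re + (R p.swap p.swap).re - 2 * (R p.swap p).re := by
    have hp := (Complex.nonneg_iff.1 (hR.diag_nonneg (i := p))).1
    have hp' := (Complex.nonneg_iff.1 (hR.diag_nonneg (i := p.swap))).1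
    have hoff := (Complex.re_le_norm _).trans (norm_apply_le_of_posSemidef hR p.swap p)
    rw [sub_sq, Real.sq_sqrt hp, Real.sq_sqrt hp']
    linarith
  have hreindex : ∑ p : n × n, (R p.swap p.swap).re = ∑ p, (R p p).re :=
    (Equiv.prodComm n n).sum_comp fun p => (R p p).re
  have hsum := Finset.sum_le_sum fun p (_ : p ∈ Finset.univ) => hterm p
  have hhalf : (1 / 2 : ℂ) = (1 / 2 : ℝ) := by norm_num
  rw [trace_costQ_mul, hhalf, Complex.re_ofReal_mul, Complex.re_sum]
  simp only [Complex.sub_re]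
  rw [Finset.sum_sub_distrib, Finset.sum_add_distrib, hreindex, ← Finset.mul_sum] at hsum
  rw [Finset.sum_sub_distrib]
  linarith

lemma half_sq_sqrt_diag_sub_le_of_mem_transportCosts {ρA ρB : Matrix n n ℂ} {c : ℝ}
    (hc : c ∈ transportCosts (costQ n) ρA ρB) (i : n) :
    1 / 2 * (√(ρA i i).re - √(ρB i i).re) ^ 2 ≤ c := by
  obtain ⟨R, ⟨⟨hR, -⟩, rfl, rfl⟩, rfl⟩ := hc
  have hdiag (p : n × n) : 0 ≤ (R p p).re := (Complex.nonneg_iff.1 hR.diag_nonneg).1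
  have hrow := two_mul_sum_row_le_sum (i := i)
    (f := fun p : n × n => (√(R p p).re - √(R p.swap p.swap).re) ^ 2)
    (fun p => sq_nonneg _) (fun p => by rw [Prod.swap_swap, sub_sq_comm]) (by simp)
  have hmarginals := sq_sqrt_sum_sub_sqrt_sum_le (fun j => hdiag (i, j)) (fun j => hdiag (j, i))
  have hcost := sum_sq_sqrt_sub_sqrt_le_re_trace_costQ_mul hR
  simp only [partialTraceA, partialTraceB, Matrix.of_apply, Complex.re_sum]
  simp only [Prod.swap_prod_mk] at hrow
  linarith

lemma half_sqrtGap_le_of_mem_transportCosts {ρA ρB : Matrix (Fin 2) (Fin 2) ℂ} {c : ℝ}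
    (hc : c ∈ transportCosts (costQ (Fin 2)) ρA ρB) (U : Matrix.unitaryGroup (Fin 2) ℂ) :
    1 / 2 * sqrtGap ρA ρB U ≤ c :=
  half_sq_sqrt_diag_sub_le_of_mem_transportCosts (conj_mem_transportCosts hc U) 0

end LowerBound

section SelfCoupling

variable {n : Type*} [Fintype n] [DecidableEq n]

lemma zero_mem_transportCosts_diagonal {d : n → ℂ}
    (hd : Matrix.diagonal d ∈ densityMatrices n) :
    0 ∈ transportCosts (costQ n) (Matrix.diagonal d) (Matrix.diagonal d) := by
  have hd_nonneg := Matrix.posSemidef_diagonal_iff.1 hd.1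
  have htrace := hd.2
  rw [Matrix.trace_diagonal] at htrace
  refine ⟨Matrix.diagonal fun p => if p.1 = p.2 then d p.1 else 0,
    ⟨⟨Matrix.PosSemidef.diagonal fun p => ?_, ?_⟩, ?_, ?_⟩, ?_⟩
  · dsimp only [Pi.zero_apply]
    split_ifs
    exacts [hd_nonneg p.1, le_rfl]
  · simpa [Matrix.trace_diagonal, Fintype.sum_prod_type] using htrace
  · ext i j
    by_cases hij : i = j <;> simp [partialTraceB, Matrix.diagonal_apply, hij]
  · ext i j
    by_cases hij : i = j <;> simp [partialTraceA, Matrix.diagonal_apply, hij]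
  · dsimp only
    rw [trace_costQ_mul, Finset.sum_eq_zero, mul_zero, Complex.zero_re]
    rintro ⟨i, j⟩ -
    by_cases hij : i = j <;> simp [hij]

lemma zero_mem_transportCosts_self {ρ : Matrix n n ℂ} (hρ : ρ ∈ densityMatrices n) :
    0 ∈ transportCosts (costQ n) ρ ρ := by
  have hH := hρ.1.1
  have hdiag : hH.eigenvectorUnitary.1ᴴ * ρ * hH.eigenvectorUnitary.1 =
      Matrix.diagonal (RCLike.ofReal ∘ hH.eigenvalues) := by
    rw [← hH.conjStarAlgAut_star_eigenvectorUnitary]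
    simp [Unitary.conjStarAlgAut_apply, Matrix.star_eq_conjTranspose]
  rw [← transportCosts_conj ρ ρ hH.eigenvectorUnitary, hdiag]
  exact zero_mem_transportCosts_diagonal (hdiag ▸ conj_mem_densityMatrices hρ _)

end SelfCoupling

section UpperBound

lemma exists_common_factor_of_isMax {n : Type*} [Fintype n] [DecidableEq n] {ρ σ : Matrix n n ℂ}
    (hρ : ρ.PosSemidef) (hσ : σ.PosSemidef) {i j : n} (hij : j ≠ i)
    (hne : (ρ i i).re ≠ (σ i i).re)
    (hmax : ∀ x, (√(quadForm ρ x) - √(quadForm σ x)) ^ 2 ≤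
      (√(ρ i i).re - √(σ i i).re) ^ 2 * quadForm 1 x) :
    ∃ z : ℂ, ρ j i = √(ρ i i).re * z ∧ σ j i = √(σ i i).re * z := by
  have hρi : 0 ≤ (ρ i i).re := (Complex.nonneg_iff.1 hρ.diag_nonneg).1
  have hσi : 0 ≤ (σ i i).re := (Complex.nonneg_iff.1 hσ.diag_nonneg).1
  have hzero {τ : Matrix n n ℂ} (hτ : τ.PosSemidef) (hτi : 0 = (τ i i).re) : τ j i = 0 := by
    simpa [← hτi] using norm_apply_le_of_posSemidef hτ j i
  rcases hρi.eq_or_lt with ha | ha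
  · have hb : √(σ i i).re ≠ 0 := (Real.sqrt_pos.2 (hσi.lt_of_ne (ha ▸ hne))).ne'
    refine ⟨σ j i / √(σ i i).re, by simp [hzero hρ ha, ← ha], ?_⟩
    rw [mul_div_cancel₀ _ (Complex.ofReal_ne_zero.2 hb)]
  have ha' : (√(ρ i i).re : ℂ) ≠ 0 := Complex.ofReal_ne_zero.2 (Real.sqrt_pos.2 ha).ne'
  refine ⟨ρ j i / √(ρ i i).re, (mul_div_cancel₀ _ ha').symm, ?_⟩
  rcases hσi.eq_or_lt with hb | hb
  · simp [hzero hσ hb, ← hb]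
  have hb' : (√(σ i i).re : ℂ) ≠ 0 := Complex.ofReal_ne_zero.2 (Real.sqrt_pos.2 hb).ne'
  have hgap : √(ρ i i).re - √(σ i i).re ≠ 0 :=
    sub_ne_zero.2 fun h => hne ((Real.sqrt_inj hρi hσi).1 h)
  simp only [← quadForm_single] at ha hb hmax
  have hEL := congrFun (euler_lagrange_sqrt_quadForm_sub hρ.1 hσ.1 ha hb hmax
    (by simp [quadForm_single])) j
  simp only [quadForm_single, Pi.smul_apply, Pi.sub_apply, Matrix.mulVec_single_one,
    Matrix.col_apply, Pi.single_eq_of_ne hij, Complex.real_smul, Complex.ofReal_inv, mul_zero,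
    mul_eq_zero, Complex.ofReal_eq_zero, hgap, false_or] at hEL
  field_simp at hEL ⊢
  linear_combination -hEL

/-- The Hermitian `2 × 2` matrix of trace one with upper left entry `a` and lower left entry `w`. -/
noncomputable def qubit (a : ℝ) (w : ℂ) : Matrix (Fin 2) (Fin 2) ℂ :=
  !![(a : ℂ), conj w; w, 1 - a]

lemma eq_qubit {ρ : Matrix (Fin 2) (Fin 2) ℂ} (hρ : ρ ∈ densityMatrices (Fin 2)) :
    ρ = qubit (ρ 0 0).re (ρ 1 0) := by
  have h00 : ((ρ 0 0).re : ℂ) = ρ 0 0 := hρ.1.1.coe_re_apply_self 0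
  have htrace := hρ.2
  rw [Matrix.trace_fin_two] at htrace
  ext i j
  fin_cases i <;> fin_cases j
  · exact h00.symm
  · exact (hρ.1.1.apply 0 1).symm
  · rfl
  · exact (eq_sub_of_add_eq' htrace).trans (by rw [← h00]; rfl)

lemma quadForm_qubit (a : ℝ) (w : ℂ) (x : Fin 2 → ℂ) :
    quadForm (qubit a w) x = a * Complex.normSq (x 0) + (1 - a) * Complex.normSq (x 1) +
      2 * (conj (x 1) * w * x 0).re := by
  simp [quadForm, qubit, dotProduct, Matrix.mulVec, Complex.normSq_apply]
  ring

lemma half_sq_sqrt_sub_mem_transportCosts_qubit {a b : ℝ} {z : ℂ} (ha : 0 ≤ a) (hb : 0 ≤ b)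
    (hz : Complex.normSq z ≤ 1 - a - b) :
    1 / 2 * (√a - √b) ^ 2 ∈
      transportCosts (costQ (Fin 2)) (qubit a (√a * z)) (qubit b (√b * z)) := by
  let ψ : Fin 2 × Fin 2 → ℂ := fun p => !![0, (√a : ℂ); (√b : ℂ), z] p.1 p.2
  let D : Fin 2 × Fin 2 → ℂ := Pi.single (1, 1) ((1 - a - b - Complex.normSq z : ℝ) : ℂ)
  have hD : (Matrix.diagonal D).PosSemidef :=
    Matrix.PosSemidef.diagonal (Pi.single_nonneg.2 (Complex.zero_le_real.2 (sub_nonneg.2 hz)))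
  have ha2 : (√a : ℂ) * √a = a := by exact_mod_cast Real.mul_self_sqrt ha
  have hb2 : (√b : ℂ) * √b = b := by exact_mod_cast Real.mul_self_sqrt hb
  have hz2 := Complex.mul_conj z
  refine ⟨Matrix.vecMulVec ψ (star ψ) + Matrix.diagonal D,
    ⟨⟨(Matrix.posSemidef_vecMulVec_self_star ψ).add hD, ?_⟩, ?_, ?_⟩, ?_⟩
  · simp [Matrix.trace, Fintype.sum_prod_type, Matrix.vecMulVec_apply, ψ, D]
    linear_combination ha2 + hb2 + hz2
  · ext i j
    fin_cases i <;> fin_cases j <;>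
      simp [partialTraceB, qubit, Matrix.vecMulVec_apply, Matrix.diagonal_apply, ψ, D]
    · linear_combination ha2
    · ring
    · linear_combination hb2 + hz2
  · ext i j
    fin_cases i <;> fin_cases j <;>
      simp [partialTraceA, qubit, Matrix.vecMulVec_apply, Matrix.diagonal_apply, ψ, D]
    · linear_combination hb2
    · ring
    · linear_combination ha2 + hz2
  · simp [trace_costQ_mul, Fintype.sum_prod_type, Matrix.vecMulVec_apply, Matrix.diagonal_apply,
      ψ, D]
    ring

lemma sq_sqrt_add_sub_sqrt_add_lt {p q t : ℝ} (hp : 0 ≤ p) (hq : 0 ≤ q) (hpq : p ≠ q)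
    (ht : 0 < t) : (√(p + t) - √(q + t)) ^ 2 < (√p - √q) ^ 2 := by
  have hgap : 0 < (√p - √q) ^ 2 := by
    have : √p - √q ≠ 0 := sub_ne_zero.2 fun h => hpq ((Real.sqrt_inj hp hq).1 h)
    positivity
  have hcross : t + √p * √q < √(p + t) * √(q + t) := by
    rw [← Real.sqrt_mul (add_nonneg hp ht.le)]
    apply Real.lt_sqrt_of_sq_lt
    calc (t + √p * √q) ^ 2 = (p + t) * (q + t) - t * (√p - √q) ^ 2 := by
          linear_combination (√q ^ 2 + t) * Real.sq_sqrt hp + (p + t) * Real.sq_sqrt hq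
      _ < (p + t) * (q + t) := by linarith [mul_pos ht hgap]
  rw [sub_sq, sub_sq, Real.sq_sqrt hp, Real.sq_sqrt hq, Real.sq_sqrt (by positivity),
    Real.sq_sqrt (by positivity)]
  linarith

/-- At this test vector the two forms exchange the roles of `a` and `b`, up to the common shift
`-t`: the right side is `b ‖x‖²`, where `a` and `b` may be swapped. -/
lemma quadForm_qubit_exchange {a b t : ℝ} {z : ℂ} (ha : 0 ≤ a) (hb : 0 ≤ b)
    (ht : t = (Complex.normSq z - (1 - a - b)) * (√a + √b) ^ 2) :
    quadForm (qubit a (√a * z)) ![-conj z, (√a + √b : ℝ)] + t =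
      b * (Complex.normSq z + (√a + √b) ^ 2) := by
  have hform : quadForm (qubit a (√a * z)) ![-conj z, (√a + √b : ℝ)] =
      a * Complex.normSq z + (1 - a) * (√a + √b) ^ 2 -
        2 * √a * (√a + √b) * Complex.normSq z := by
    simp [quadForm_qubit, Complex.normSq_apply]
    ring
  rw [hform, ht]
  linear_combination Complex.normSq z * Real.sq_sqrt hb - Complex.normSq z * Real.sq_sqrt ha

lemma normSq_le_of_isMax {a b : ℝ} {z : ℂ} (ha : 0 ≤ a) (hb : 0 ≤ b) (hab : a ≠ b)
    (hA : (qubit a (√a * z)).PosSemidef) (hB : (qubit b (√b * z)).PosSemidef)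
    (hmax : ∀ x, (√(quadForm (qubit a (√a * z)) x) - √(quadForm (qubit b (√b * z)) x)) ^ 2 ≤
      (√a - √b) ^ 2 * quadForm 1 x) :
    Complex.normSq z ≤ 1 - a - b := by
  by_contra! hz
  set x : Fin 2 → ℂ := ![-conj z, (√a + √b : ℝ)]
  set K := Complex.normSq z + (√a + √b) ^ 2
  set t := (Complex.normSq z - (1 - a - b)) * (√a + √b) ^ 2 with ht
  have hsum : 0 < √a + √b := by
    rcases ha.lt_or_eq with ha' | rfl
    · exact add_pos_of_pos_of_nonneg (Real.sqrt_pos.2 ha') (Real.sqrt_nonneg b)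
    · exact add_pos_of_nonneg_of_pos (Real.sqrt_nonneg 0) (Real.sqrt_pos.2 (hb.lt_of_ne hab))
  have ht_pos : 0 < t := mul_pos (sub_pos.2 hz) (pow_pos hsum 2)
  have hK_pos : 0 < K := add_pos_of_nonneg_of_pos (Complex.normSq_nonneg z) (pow_pos hsum 2)
  have hone : quadForm 1 x = K := by
    simp [quadForm, dotProduct, Fin.sum_univ_two, x, K, Complex.normSq_apply]
    ring
  have hAx : quadForm (qubit a (√a * z)) x + t = b * K := quadForm_qubit_exchange ha hb ht
  have hBx : quadForm (qubit b (√b * z)) x + t = a * K := by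
    simpa only [add_comm √b] using! quadForm_qubit_exchange (t := t) (z := z) hb ha
      (by rw [ht, add_comm √a]; ring)
  have hne : quadForm (qubit a (√a * z)) x ≠ quadForm (qubit b (√b * z)) x := fun h =>
    hab (mul_right_cancel₀ hK_pos.ne' (by rw [← hAx, ← hBx, h]))
  refine (sq_sqrt_add_sub_sqrt_add_lt (quadForm_nonneg hA x) (quadForm_nonneg hB x) hne
    ht_pos).not_ge ?_
  calc (√(quadForm (qubit a (√a * z)) x + t) - √(quadForm (qubit b (√b * z)) x + t)) ^ 2
      = (√(b * K) - √(a * K)) ^ 2 := by rw [hAx, hBx]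
    _ = (√a - √b) ^ 2 * K := by
      rw [Real.sqrt_mul ha, Real.sqrt_mul hb, ← sub_mul, mul_pow, Real.sq_sqrt hK_pos.le,
        sub_sq_comm]
    _ ≥ _ := hone ▸ hmax x

lemma half_sq_sqrt_sub_mem_transportCosts_of_isMax {ρA ρB : Matrix (Fin 2) (Fin 2) ℂ}
    (hA : ρA ∈ densityMatrices (Fin 2)) (hB : ρB ∈ densityMatrices (Fin 2))
    (hmax : ∀ x, (√(quadForm ρA x) - √(quadForm ρB x)) ^ 2 ≤
      (√(ρA 0 0).re - √(ρB 0 0).re) ^ 2 * quadForm 1 x) :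
    1 / 2 * (√(ρA 0 0).re - √(ρB 0 0).re) ^ 2 ∈ transportCosts (costQ (Fin 2)) ρA ρB := by
  by_cases hne : (ρA 0 0).re = (ρB 0 0).re
  · obtain rfl : ρA = ρB := ext_quadForm hA.1.1 hB.1.1 fun x => by
      have hx := hmax x
      rw [hne, sub_self, zero_pow two_ne_zero, zero_mul] at hx
      exact (Real.sqrt_inj (quadForm_nonneg hA.1 x) (quadForm_nonneg hB.1 x)).1
        (sub_eq_zero.1 (pow_eq_zero_iff two_ne_zero |>.1 (le_antisymm hx (sq_nonneg _))))
    simpa using zero_mem_transportCosts_self hA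
  · obtain ⟨z, hzA, hzB⟩ := exists_common_factor_of_isMax hA.1 hB.1 one_ne_zero hne hmax
    have ha : 0 ≤ (ρA 0 0).re := (Complex.nonneg_iff.1 hA.1.diag_nonneg).1
    have hb : 0 ≤ (ρB 0 0).re := (Complex.nonneg_iff.1 hB.1.diag_nonneg).1
    have hqA := hzA ▸ eq_qubit hA
    have hqB := hzB ▸ eq_qubit hB
    generalize (ρA 0 0).re = a at *
    generalize (ρB 0 0).re = b at *
    subst hqA hqB
    exact half_sq_sqrt_sub_mem_transportCosts_qubit ha hb
      (normSq_le_of_isMax ha hb hne hA.1 hB.1 hmax)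

lemma sqrtGap_eq (ρA ρB : Matrix (Fin 2) (Fin 2) ℂ) (U : Matrix.unitaryGroup (Fin 2) ℂ) :
    sqrtGap ρA ρB U = (√(quadForm ρA (U.1.col 0)) - √(quadForm ρB (U.1.col 0))) ^ 2 := by
  rw [sqrtGap, quadForm_col, quadForm_col]

lemma sqrtGap_conj (ρA ρB : Matrix (Fin 2) (Fin 2) ℂ) (U V : Matrix.unitaryGroup (Fin 2) ℂ) :
    sqrtGap (U.1ᴴ * ρA * U.1) (U.1ᴴ * ρB * U.1) V = sqrtGap ρA ρB (U * V) := by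
  simp only [sqrtGap, Submonoid.coe_mul, Matrix.conjTranspose_mul, Matrix.mul_assoc]

lemma sq_sqrt_quadForm_sub_le_of_sqrtGap_le {ρA ρB : Matrix (Fin 2) (Fin 2) ℂ} {c : ℝ}
    (hc : ∀ U, sqrtGap ρA ρB U ≤ c) (x : Fin 2 → ℂ) :
    (√(quadForm ρA x) - √(quadForm ρB x)) ^ 2 ≤ c * quadForm 1 x := by
  have hx_nonneg := quadForm_nonneg Matrix.PosSemidef.one x
  rcases hx_nonneg.eq_or_lt with hx | hx
  · obtain rfl := quadForm_one_eq_zero.1 hx.symm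
    simp [quadForm]
  set r := √(quadForm 1 x)
  have hunit : quadForm 1 (r⁻¹ • x) = 1 := by
    rw [quadForm_smul, inv_pow, Real.sq_sqrt hx_nonneg, inv_mul_cancel₀ hx.ne']
  obtain ⟨U, hU⟩ := exists_mem_unitaryGroup_col_eq hunit 0
  have hgap := hc U
  have hscale (ρ) : √(quadForm ρ (r⁻¹ • x)) = r⁻¹ * √(quadForm ρ x) := by
    rw [quadForm_smul, Real.sqrt_mul (sq_nonneg _),
      Real.sqrt_sq (inv_nonneg.2 (Real.sqrt_nonneg _))]
  rwa [sqrtGap_eq, hU, hscale, hscale, ← mul_sub, mul_pow, inv_pow, Real.sq_sqrt hx_nonneg,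
    inv_mul_le_iff₀' hx] at hgap

lemma half_sqrtGap_mem_transportCosts_of_isMax {ρA ρB : Matrix (Fin 2) (Fin 2) ℂ}
    (hA : ρA ∈ densityMatrices (Fin 2)) (hB : ρB ∈ densityMatrices (Fin 2))
    {U : Matrix.unitaryGroup (Fin 2) ℂ} (hU : ∀ V, sqrtGap ρA ρB V ≤ sqrtGap ρA ρB U) :
    1 / 2 * sqrtGap ρA ρB U ∈ transportCosts (costQ (Fin 2)) ρA ρB := by
  rw [← transportCosts_conj ρA ρB U]
  exact half_sq_sqrt_sub_mem_transportCosts_of_isMax (conj_mem_densityMatrices hA U)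
    (conj_mem_densityMatrices hB U)
    (sq_sqrt_quadForm_sub_le_of_sqrtGap_le fun V => (sqrtGap_conj ρA ρB U V).trans_le (hU _))

lemma continuous_sqrtGap (ρA ρB : Matrix (Fin 2) (Fin 2) ℂ) : Continuous (sqrtGap ρA ρB) := by
  unfold sqrtGap
  fun_prop

lemma exists_forall_sqrtGap_le (ρA ρB : Matrix (Fin 2) (Fin 2) ℂ) :
    ∃ U, ∀ V, sqrtGap ρA ρB V ≤ sqrtGap ρA ρB U := by
  have : CompactSpace (Matrix.unitaryGroup (Fin 2) ℂ) :=
    isCompact_iff_compactSpace.1 isCompact_unitaryGroup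
  obtain ⟨U, -, hU⟩ :=
    isCompact_univ.exists_isMaxOn Set.univ_nonempty (continuous_sqrtGap ρA ρB).continuousOn
  exact ⟨U, fun V => hU (Set.mem_univ V)⟩

end UpperBound

end QOT

theorem theorem7p2 (ρA ρB : Matrix (Fin 2) (Fin 2) ℂ)
    (hA : ρA ∈ QOT.densityMatrices (Fin 2)) (hB : ρB ∈ QOT.densityMatrices (Fin 2)) :
    IsLeast (QOT.transportCosts (QOT.costQ (Fin 2)) ρA ρB)
        (QOT.transport (QOT.costQ (Fin 2)) ρA ρB) ∧
      IsGreatest (Set.range (QOT.sqrtGap ρA ρB))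
        (⨆ U : Matrix.unitaryGroup (Fin 2) ℂ, QOT.sqrtGap ρA ρB U) ∧
      QOT.transport (QOT.costQ (Fin 2)) ρA ρB =
        1 / 2 * ⨆ U : Matrix.unitaryGroup (Fin 2) ℂ, QOT.sqrtGap ρA ρB U := by
  obtain ⟨U, hU⟩ := QOT.exists_forall_sqrtGap_le ρA ρB
  have hgreatest : IsGreatest (Set.range (QOT.sqrtGap ρA ρB)) (QOT.sqrtGap ρA ρB U) :=
    ⟨Set.mem_range_self U, Set.forall_mem_range.2 hU⟩
  have hleast : IsLeast (QOT.transportCosts (QOT.costQ (Fin 2)) ρA ρB)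
      (1 / 2 * QOT.sqrtGap ρA ρB U) :=
    ⟨QOT.half_sqrtGap_mem_transportCosts_of_isMax hA hB hU,
      fun _ hc => QOT.half_sqrtGap_le_of_mem_transportCosts hc U⟩
  have hmax : ⨆ V, QOT.sqrtGap ρA ρB V = QOT.sqrtGap ρA ρB U := hgreatest.csSup_eq
  have hmin : QOT.transport (QOT.costQ (Fin 2)) ρA ρB = 1 / 2 * QOT.sqrtGap ρA ρB U :=
    hleast.csInf_eq
  rw [hmax, hmin]
  exact ⟨hleast, hgreatest, rfl⟩
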